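/- **Setting.** In a $K$-user blind index coding (BIC) problem with parameters $\mu_{ij}\in[0,1]$ ($i\neq j\in\{1,\dots,K\}$) a sender holds independent messages $\vec w_1,\dots,\vec w_K$, where $\vec w_j$ is uniform on $\{0,1\}^{m_j}$ and is desired by User $j$. For all $i\ne j$, User $i$ knows $\vec g_{ij}\in\{0,1\}^{m_j}$, whose bits are Bernoulli$(1-\mu_{ij})$, and $\vec\phi_{ij}$ with $\phi_{ij}[\ell]=g_{ij}[\ell]\,w_j[\ell]$; all bits of all $\vec g_{ij}$ and all messages are independent. A scheme with block length $n$ consists of message lengths $m_1,\dots,m_K$, an encoder $\prod_j\{0,1\}^{m_j}\to\{0,1\}^n$, $(\vec w_1,\dots,\vec w_K)\mapsto\vec x$ (which does not see the $\vec g_{ij}$, $\vec\phi_{ij}$), and for each $i$ a decoder that maps $\vec x$ and $(\vec\phi_{ij},\vec g_{ij})_{j\ne i}$ to an estimate $\widehat{\vec w}_i\in\{0,1\}^{m_i}$. The rate tuple $(r_1,\dots,r_K)$ is achievable if there is a sequence of schemes with strictly increasing block lengths $n$ along which $m_j/n\to r_j$ and $\Pr[\widehat{\vec w}_j\ne\vec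 w_j]\to0$ for every $j$. A $K$-user *outer bound tree* (OBT) is a rooted tree with levels $1,\dots,K$ in which node $i$ of level $\ell$ carries a label $v[\ell,i]\in\{1,\dots,K\}$, where $1\le i\le 2^{\ell-1}$ if $\ell<K$ and $1\le i\le 2^{K-2}$ if $\ell=K$. For $\ell\le K-2$, node $i$ of level $\ell$ has the left child $2i-1$ and the right child $2i$ in level $\ell+1$; node $i$ of level $K-1$ has the only child $i$ in level $K$. No label is repeated on a path from the root to a leaf, and two nodes with the same parent have different labels. **Theorem.** Let $K\ge3$, and let $(r_1,\dots,r_K)$ be achievable for the $K$-user BIC problem with parameters $\mu_{ij}\in[0,1]$. Then, for every $K$-user OBT, $$\Gamma_A[1,1]\le 1 .$$ Here, with $[a]^+=\max\{a,0\}$, $$\Gamma_A[\ell,i]=\begin{cases} r_{v[\ell,i]}+\zeta[\ell,i]\,\Gamma_A[\ell+1,2i-1]+(1-\zeta[\ell,i])\,\Gamma_B[\ell+1,2i] & \ell<K-1\\ r_{v[\ell,i]}+\zeta[\ell,i]\,r_{v[\ell+1,i]} & \ell=K-1\\ 0&\text{otherwise,}\end{cases}$$ $$\Gamma_B[\ell,i]=\begin{cases}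 \eta_{v[\ell,i]}[\ell-1,\lceil i/2\rceil]\,r_{v[\ell,i]}+\zeta[\ell,i]\,\Gamma_A[\ell+1,2i-1]+(1-\zeta[\ell,i])\,\Gamma_B[\ell+1,2i] & \ell<K-1\\ \eta_{v[\ell,i]}[\ell-1,\lceil i/2\rceil]\,r_{v[\ell,i]}+\zeta[\ell,i]\,r_{v[\ell+1,i]} & \ell=K-1\\ 0&\text{otherwise,}\end{cases}$$ $$\zeta[\ell,i]=\begin{cases}\dfrac{\big[\eta_{v[\ell+1,2i-1]}[\ell,i]-\mu_{v[\ell+1,2i],\,v[\ell+1,2i-1]}\big]^+}{1-\mu_{v[\ell+1,2i],\,v[\ell+1,2i-1]}} & \ell<K-1\\ \eta_{v[\ell+1,i]}[\ell,i] & \ell=K-1\\ 0&\text{otherwise,}\end{cases}$$ where $0/0$ is read as $0$; and, with the convention $\mu_{jj}=1$, $\eta_j[1,1]=1$ if $j=v[1,1]$ and $\eta_j[1,1]=\mu_{v[1,1],j}$ otherwise, and for $1<\ell<K$ $$\eta_j[\ell,i]=\begin{cases}1& j=v[\ell,i],\ i\text{ odd}\\ 0& j=v[\ell-1,\lceil i/2\rceil]\\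 \min\{\mu_{v[\ell,i],j},\ \eta_j[\ell-1,\lceil i/2\rceil]\}&\text{otherwise.}\end{cases}$$ -/

import Mathlib

open Filter Topology

noncomputable section

namespace BIC

/-! ### The blind index coding problem -/

/-- A tuple of messages: message `j` is a string of `m j` bits. -/
abbrev Messages {K : ℕ} (m : Fin K → ℕ) : Type := ∀ j : Fin K, Fin (m j) → Bool

/-- The side information states `g i j`, one binary vector of length `m j` for every user `i`
and every message `j ≠ i`. -/
abbrev States {K : ℕ} (m : Fin K → ℕ) : Type :=
  ∀ (i : Fin K) (j : {j : Fin K // j ≠ i}), Fin (m j) → Bool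

/-- A scheme with block length `n`: message lengths, one encoder which sees the messages only,
and for each user a decoder which sees the channel input and the pairs `(φ i j, g i j)`, `j ≠ i`. -/
structure Scheme (K n : ℕ) where
  /-- message lengths in bits -/
  m : Fin K → ℕ
  /-- encoding function -/
  enc : Messages m → (Fin n → Bool)
  /-- decoding functions -/
  dec : ∀ i : Fin K, (Fin n → Bool) →
    (∀ j : {j : Fin K // j ≠ i}, (Fin (m j) → Bool) × (Fin (m j) → Bool)) → (Fin (m i) → Bool)

/-- The side information signal `φ i j`, with bits `g i j l * w j l`. -/
def sideInfo {K : ℕ} {m : Fin K → ℕ} (w : Messages m) (g : States m)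
    (i : Fin K) (j : {j : Fin K // j ≠ i}) : Fin (m j) → Bool :=
  fun l => g i j l && w j l

/-- The joint probability mass function of messages and side information states: all bits are
independent, message bits are uniform, and each bit of `g i j` is `1` with probability
`1 - μ i j`. -/
def outcomeProb {K : ℕ} (μ : Fin K → Fin K → ℝ) {m : Fin K → ℕ}
    (_w : Messages m) (g : States m) : ℝ :=
  (∏ j : Fin K, (1 / 2 : ℝ) ^ m j) *
    ∏ i : Fin K, ∏ j : {j : Fin K // j ≠ i}, ∏ l : Fin (m j),
      (if g i j l then 1 - μ i j else μ i j)

/-- The estimate that user `i` forms of its desired message. -/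
def Scheme.estimate {K n : ℕ} (S : Scheme K n) (w : Messages S.m) (g : States S.m)
    (i : Fin K) : Fin (S.m i) → Bool :=
  S.dec i (S.enc w) (fun j => (sideInfo w g i j, g i j))

/-- The probability that user `i` decodes its desired message incorrectly. -/
def Scheme.errorProb {K n : ℕ} (μ : Fin K → Fin K → ℝ) (S : Scheme K n) (i : Fin K) : ℝ :=
  ∑ w : Messages S.m, ∑ g : States S.m,
    if S.estimate w g i ≠ w i then outcomeProb μ w g else 0

/-- Achievability of a rate tuple `r`: there are schemes with increasing block lengths `N t`,
with `m j / N t → r j` for all `j`, whose error probabilities all tend to `0`. -/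
def Achievable {K : ℕ} (μ : Fin K → Fin K → ℝ) (r : Fin K → ℝ) : Prop :=
  ∃ (N : ℕ → ℕ) (S : ∀ t : ℕ, Scheme K (N t)), StrictMono N ∧
    (∀ j : Fin K, Tendsto (fun t => ((S t).m j : ℝ) / (N t : ℝ)) atTop (𝓝 (r j))) ∧
    ∀ i : Fin K, Tendsto (fun t => (S t).errorProb μ i) atTop (𝓝 0)

/-! ### Outer bound trees -/

/-- The index of the node in level `ℓ` on the path from the root to the leaf `i` (a node of
level `K`). Leaf `i` is the only child of node `i` in level `K - 1`, and above that level the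
parent of node `a` is node `⌈a / 2⌉`; for `ℓ = K` and `ℓ = K - 1` the result is `i`. -/
def pathIndex (K i ℓ : ℕ) : ℕ := (fun a => (a + 1) / 2)^[K - 1 - ℓ] i

/-- A `K`-user outer bound tree. The nodes are the pairs `(ℓ, i)` with `1 ≤ ℓ ≤ K`, where
`1 ≤ i ≤ 2 ^ (ℓ - 1)` for `ℓ < K` and `1 ≤ i ≤ 2 ^ (K - 2)` for `ℓ = K`; values of `label`
elsewhere are never used. Nodes `2 * i - 1` and `2 * i` in level `ℓ + 1 < K` are the left and
right children of node `i` in level `ℓ`. -/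
structure OuterBoundTree (K : ℕ) where
  /-- the label of node `i` in level `ℓ` -/
  label : ℕ → ℕ → Fin K
  /-- no label is repeated on a path from the root to a leaf -/
  path_injective : ∀ i : ℕ, 1 ≤ i → i ≤ 2 ^ (K - 2) →
    Set.InjOn (fun ℓ => label ℓ (pathIndex K i ℓ)) (Set.Icc 1 K)
  /-- two nodes with the same parent have different labels -/
  siblings_ne : ∀ ℓ i : ℕ, 1 ≤ ℓ → ℓ + 1 < K → 1 ≤ i → i ≤ 2 ^ (ℓ - 1) →
    label (ℓ + 1) (2 * i - 1) ≠ label (ℓ + 1) (2 * i)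

/-- The coefficient `η_j[ℓ, i]`, for levels `1 ≤ ℓ < K` (level `0` is a dummy). The third
branch for levels `ℓ ≥ 2` is the convention `μ_jj = 1`: a user has no side information about the
message that it desires. -/
def eta {K : ℕ} (μ : Fin K → Fin K → ℝ) (v : ℕ → ℕ → Fin K) : ℕ → ℕ → Fin K → ℝ
  | 0, _, _ => 0
  | 1, i, j => if j = v 1 i then 1 else μ (v 1 i) j
  | ℓ + 2, i, j =>
    if j = v (ℓ + 2) i ∧ Odd i then 1
    else if j = v (ℓ + 1) ((i + 1) / 2) then 0
    else if j = v (ℓ + 2) i then eta μ v (ℓ + 1) ((i + 1) / 2) j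
    else min (μ (v (ℓ + 2) i) j) (eta μ v (ℓ + 1) ((i + 1) / 2) j)

/-- The coefficient `ζ[ℓ, i]`. If the denominator is `0`, then so is the numerator, and the
quotient is read as `0`. -/
def zeta {K : ℕ} (μ : Fin K → Fin K → ℝ) (v : ℕ → ℕ → Fin K) (ℓ i : ℕ) : ℝ :=
  if ℓ + 1 < K then
    max (eta μ v ℓ i (v (ℓ + 1) (2 * i - 1)) - μ (v (ℓ + 1) (2 * i)) (v (ℓ + 1) (2 * i - 1))) 0 /
      (1 - μ (v (ℓ + 1) (2 * i)) (v (ℓ + 1) (2 * i - 1)))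
  else if ℓ + 1 = K then eta μ v ℓ i (v (ℓ + 1) i)
  else 0

mutual

/-- The quantity `Γ_A[ℓ, i]`. -/
def GammaA {K : ℕ} (μ : Fin K → Fin K → ℝ) (r : Fin K → ℝ) (v : ℕ → ℕ → Fin K)
    (ℓ i : ℕ) : ℝ :=
  if ℓ + 1 < K then
    r (v ℓ i) + zeta μ v ℓ i * GammaA μ r v (ℓ + 1) (2 * i - 1)
      + (1 - zeta μ v ℓ i) * GammaB μ r v (ℓ + 1) (2 * i)
  else if ℓ + 1 = K then r (v ℓ i) + zeta μ v ℓ i * r (v (ℓ + 1) i)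
  else 0
termination_by K - ℓ

/-- The quantity `Γ_B[ℓ, i]`, for levels `ℓ ≥ 2`. -/
def GammaB {K : ℕ} (μ : Fin K → Fin K → ℝ) (r : Fin K → ℝ) (v : ℕ → ℕ → Fin K)
    (ℓ i : ℕ) : ℝ :=
  if ℓ + 1 < K then
    eta μ v (ℓ - 1) ((i + 1) / 2) (v ℓ i) * r (v ℓ i)
      + zeta μ v ℓ i * GammaA μ r v (ℓ + 1) (2 * i - 1)
      + (1 - zeta μ v ℓ i) * GammaB μ r v (ℓ + 1) (2 * i)
  else if ℓ + 1 = K then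
    eta μ v (ℓ - 1) ((i + 1) / 2) (v ℓ i) * r (v ℓ i) + zeta μ v ℓ i * r (v (ℓ + 1) i)
  else 0
termination_by K - ℓ

end

end BIC

end

-- Messages are uniform, so entropies are counted by fibres: `meanLog f` is the entropy of the
-- messages W given f(W), and `meanLog h` minus the `meanLog` of the pair (f, h) is H(f | h).
--
-- For a profile η in [0,1]^K let h(η) (`channelEntropy`) be the entropy of the channel input X
-- given a genie that erases each bit of message j with probability η_j, independently, and reveals
-- the rest. The encoder does not see the states, so only the erasure probabilities matter. Three
-- properties carry the proof.
--
-- Decoding (`channelEntropy_decode`): if η_j ≤ μ_ij for all j ≠ i, the genie is at least as good as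
-- the side information of user i. The chain rule and Fano's inequality then give h(η) ≥ η_i m_i log
-- 2 + h(η with η_i = 0), up to an error term.
--
-- Monotonicity (`channelEntropy_mono`): more erasures leave more entropy in X.
--
-- Concavity along nonnegative directions (`channelEntropy_concave`): message bits are independent,
-- so H(X | known bits) is a submodular function of the set of unknown bits, and h is its
-- multilinear extension restricted to profiles constant on each message.
--
-- In the tree, the vector η at a node is a profile from which its label can decode. After decoding,
-- the remaining profile is a mixture, with weights ζ and 1 - ζ, of two profiles that dominate those
-- of the children (`channelEntropy_branch`). Induction from the leaves bounds Γ at a node by h(η)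
-- plus error terms (`Gamma_le_channelEntropy`). At the root h ≤ n log 2; dividing by n log 2 and
-- letting n grow gives the bound.

noncomputable section

namespace BIC

/-! ### Entropies of functions of a uniform variable -/

section Entropy

variable {Ω α β γ : Type*} [Fintype Ω]

open Classical in
/-- The number of points of `Ω` that `f` does not distinguish from `w`. -/
def fiberCard (f : Ω → α) (w : Ω) : ℕ := (Finset.univ.filter fun u => f u = f w).card

lemma fiberCard_pos (f : Ω → α) (w : Ω) : 0 < fiberCard f w :=
  Finset.card_pos.2 ⟨w, by simp⟩

/-- The mean of `log (fiberCard f w)` over a uniform `w`, which is `log |Ω|` minus the entropy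
of `f`. -/
def meanLog (f : Ω → α) : ℝ := (∑ w, Real.log (fiberCard f w)) / Fintype.card Ω

lemma meanLog_congr {f : Ω → α} {g : Ω → β} (h : ∀ u w, f u = f w ↔ g u = g w) :
    meanLog f = meanLog g := by
  have : fiberCard f = fiberCard g := by
    funext w
    unfold fiberCard
    congr 1
    ext u
    simp [h u w]
  rw [meanLog, meanLog, this]

/-- Gibbs' inequality for a conditional distribution `q`. -/
theorem sum_log_fiberCard_le [Fintype α] (f : Ω → α) (h : Ω → γ) (q : α → γ → ℝ)
    (hq : ∀ a c, 0 ≤ q a c) (hsum : ∀ c, ∑ a, q a c ≤ 1) (hpos : ∀ w, 0 < q (f w) (h w)) :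
    ∑ w, (Real.log (fiberCard h w) - Real.log (fiberCard (fun u => (f u, h u)) w)) ≤
      ∑ w, -Real.log (q (f w) (h w)) := by
  classical
  have hN : ∀ w, (0 : ℝ) < fiberCard h w := fun w => by exact_mod_cast fiberCard_pos h w
  have hM : ∀ w, (0 : ℝ) < fiberCard (fun u => (f u, h u)) w := fun w => by
    exact_mod_cast fiberCard_pos _ w
  -- The ratio of the two fibre sizes is 1/p, with p the true conditional probability of f given h.
  -- The mean of q/p is at most 1, and log x ≤ x - 1 finishes.
  have key : ∑ w, q (f w) (h w) * fiberCard h w / fiberCard (fun u => (f u, h u)) w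
      ≤ ∑ _w : Ω, (1 : ℝ) := by
    have e1 : ∀ w, q (f w) (h w) * fiberCard h w / fiberCard (fun u => (f u, h u)) w
        = ∑ u, if h u = h w then q (f w) (h u) / fiberCard (fun u => (f u, h u)) w else 0 := by
      intro w
      rw [← Finset.sum_filter, Finset.sum_congr rfl (g := fun _ =>
        q (f w) (h w) / fiberCard (fun u => (f u, h u)) w)]
      · rw [Finset.sum_const, nsmul_eq_mul, fiberCard]
        ring_nf
      · intro u hu
        rw [(Finset.mem_filter.1 hu).2]
    rw [Finset.sum_congr rfl fun w _ => e1 w, Finset.sum_comm]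
    refine Finset.sum_le_sum fun u _ => le_trans ?_ (hsum (h u))
    rw [← Finset.sum_fiberwise Finset.univ f]
    refine Finset.sum_le_sum fun a _ => ?_
    rw [← Finset.sum_filter, Finset.filter_filter]
    rw [Finset.sum_congr rfl (g := fun _ => q a (h u) /
      ((Finset.univ.filter fun w => f w = a ∧ h u = h w).card : ℝ))]
    · rw [Finset.sum_const, nsmul_eq_mul]
      rcases Nat.eq_zero_or_pos (Finset.univ.filter fun w => f w = a ∧ h u = h w).card with h0 | h0
      · rw [h0]; simpa using hq a (h u)
      · rw [mul_div_cancel₀]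
        exact_mod_cast h0.ne'
    · intro w hw
      obtain ⟨h1, h2⟩ := (Finset.mem_filter.1 hw).2
      rw [h1, fiberCard]
      congr 3
      ext w'
      simp [h1, h2, Prod.ext_iff, eq_comm]
  have h2 : ∑ w, (Real.log (fiberCard h w) - Real.log (fiberCard (fun u => (f u, h u)) w)
      + Real.log (q (f w) (h w))) ≤
      ∑ w, (q (f w) (h w) * fiberCard h w / fiberCard (fun u => (f u, h u)) w - 1) := by
    refine Finset.sum_le_sum fun w _ => ?_
    have := Real.log_le_sub_one_of_pos (div_pos (mul_pos (hpos w) (hN w)) (hM w))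
    rw [Real.log_div (mul_pos (hpos w) (hN w)).ne' (hM w).ne',
      Real.log_mul (hpos w).ne' (hN w).ne'] at this
    linarith
  rw [Finset.sum_sub_distrib] at h2
  rw [Finset.sum_add_distrib] at h2
  rw [Finset.sum_neg_distrib]
  linarith

theorem meanLog_sub_le [Fintype α] (f : Ω → α) (h : Ω → γ) (q : α → γ → ℝ)
    (hq : ∀ a c, 0 ≤ q a c) (hsum : ∀ c, ∑ a, q a c ≤ 1) (hpos : ∀ w, 0 < q (f w) (h w)) :
    meanLog h - meanLog (fun u => (f u, h u)) ≤
      (∑ w, -Real.log (q (f w) (h w))) / Fintype.card Ω := by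
  rw [meanLog, meanLog, ← sub_div, ← Finset.sum_sub_distrib]
  exact div_le_div_of_nonneg_right (sum_log_fiberCard_le f h q hq hsum hpos) (Nat.cast_nonneg _)

/-- Conditioning reduces entropy. -/
theorem meanLog_cond_le [Fintype α] (f : Ω → α) (g : Ω → β) (h : Ω → γ) :
    meanLog (fun u => (g u, h u)) - meanLog (fun u => (f u, (g u, h u))) ≤
      meanLog h - meanLog (fun u => (f u, h u)) := by
  classical
  -- The law of f given h alone, ignoring g. It is 0 off the range of h, hence total mass at most 1
  -- rather than equal to 1.
  let q : α → β × γ → ℝ := fun a c =>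
    ((Finset.univ.filter fun u => f u = a ∧ h u = c.2).card : ℝ) /
      ((Finset.univ.filter fun u => h u = c.2).card : ℝ)
  have hqe : ∀ w, q (f w) (g w, h w) =
      (fiberCard (fun u => (f u, h u)) w : ℝ) / fiberCard h w := by
    intro w
    simp only [q, fiberCard, Prod.mk.injEq]
  have hN : ∀ w, (0 : ℝ) < fiberCard h w := fun w => by exact_mod_cast fiberCard_pos h w
  have hM : ∀ w, (0 : ℝ) < fiberCard (fun u => (f u, h u)) w := fun w => by
    exact_mod_cast fiberCard_pos _ w
  refine (meanLog_sub_le f (fun u => (g u, h u)) q (fun a c => by positivity) ?_ ?_).trans ?_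
  · intro c
    simp only [q]
    rw [← Finset.sum_div, ← Nat.cast_sum]
    refine div_le_one_of_le₀ ?_ (Nat.cast_nonneg _)
    rw [Finset.card_eq_sum_card_fiberwise (f := f) (t := Finset.univ) (fun _ _ => Finset.mem_univ _)]
    simp [Finset.filter_filter, and_comm]
  · intro w
    rw [hqe]
    exact div_pos (hM w) (hN w)
  · rw [meanLog, meanLog, ← sub_div, ← Finset.sum_sub_distrib]
    refine le_of_eq ?_
    congr 1
    refine Finset.sum_congr rfl fun w _ => ?_
    rw [hqe, Real.log_div (hM w).ne' (hN w).ne']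
    ring

/-- The entropy of a variable with values in `α` is at most `log |α|`. -/
theorem meanLog_sub_le_log_card [Fintype α] [Nonempty Ω] (f : Ω → α) (h : Ω → γ) :
    meanLog h - meanLog (fun u => (f u, h u)) ≤ Real.log (Fintype.card α) := by
  have : Nonempty α := ⟨f (Classical.arbitrary Ω)⟩
  have hc : (0 : ℝ) < Fintype.card α := by exact_mod_cast Fintype.card_pos
  have hΩ : (0 : ℝ) < Fintype.card Ω := by exact_mod_cast Fintype.card_pos
  refine (meanLog_sub_le f h (fun _ _ => (Fintype.card α : ℝ)⁻¹) (fun _ _ => by positivity)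
    (fun _ => by simp [hc.ne']) (fun _ => by positivity)).trans ?_
  simp [hΩ.ne']

open Classical in
/-- Fano's inequality. -/
theorem meanLog_sub_le_fano [Fintype α] [Nonempty Ω] (f : Ω → α) (h : Ω → γ) (d : γ → α) :
    meanLog h - meanLog (fun u => (f u, h u)) ≤
      Real.log 2 + (∑ w, if d (h w) ≠ f w then (1 : ℝ) else 0) / Fintype.card Ω *
        Real.log (Fintype.card α) := by
  have : Nonempty α := ⟨f (Classical.arbitrary Ω)⟩
  have hc : (0 : ℝ) < Fintype.card α := by exact_mod_cast Fintype.card_pos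
  have hΩ : (0 : ℝ) < Fintype.card Ω := by exact_mod_cast Fintype.card_pos
  -- Mass 1/2 on the guess and 1/(2|α|) on every other value; this yields log 2 in place of the
  -- binary entropy.
  let q : α → γ → ℝ := fun a c => if d c ≠ a then (2 * Fintype.card α : ℝ)⁻¹ else 2⁻¹
  have hq : ∀ a c, 0 < q a c := fun a c => by
    simp only [q]; split_ifs <;> positivity
  refine (meanLog_sub_le f h q (fun a c => (hq a c).le) ?_ fun w => hq _ _).trans ?_
  · intro c
    have : ∀ a, q a c ≤ (2 * Fintype.card α : ℝ)⁻¹ + if d c = a then 2⁻¹ else 0 := by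
      intro a
      have : (0 : ℝ) ≤ (2 * Fintype.card α : ℝ)⁻¹ := by positivity
      by_cases h1 : d c = a <;> simp [q, h1]
    refine (Finset.sum_le_sum fun a _ => this a).trans ?_
    rw [Finset.sum_add_distrib, Finset.sum_ite_eq]
    simp only [Finset.sum_const, Finset.card_univ, nsmul_eq_mul, Finset.mem_univ, if_true]
    refine le_of_eq ?_
    field_simp
    norm_num
  · have : ∀ w, -Real.log (q (f w) (h w)) =
        Real.log 2 + (if d (h w) ≠ f w then (1 : ℝ) else 0) * Real.log (Fintype.card α) := by
      intro w
      by_cases h1 : d (h w) = f w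
      · simp [q, h1]
      · simp only [q, ne_eq, h1, not_false_eq_true, if_true, one_mul]
        rw [Real.log_inv, neg_neg, Real.log_mul two_ne_zero hc.ne']
    rw [Finset.sum_congr rfl fun w _ => this w, Finset.sum_add_distrib, ← Finset.sum_mul, add_div]
    simp only [Finset.sum_const, Finset.card_univ, nsmul_eq_mul]
    refine le_of_eq ?_
    field_simp

end Entropy

/-! ### Multilinear extensions -/

section Multilinear

open Function

variable {B : Type*} [Fintype B]

/-- The probability of the pattern `s` if bit `b` is erased (`s b = false`) with
probability `p b`. -/
def patternProb (p : B → ℝ) (s : B → Bool) : ℝ := ∏ b, if s b then 1 - p b else p b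

lemma patternProb_nonneg {p : B → ℝ} (h0 : ∀ b, 0 ≤ p b) (h1 : ∀ b, p b ≤ 1) (s : B → Bool) :
    0 ≤ patternProb p s :=
  Finset.prod_nonneg fun b _ => by
    have := h0 b
    have := h1 b
    split_ifs <;> linarith

variable [DecidableEq B]

/-- The mean of `F s` over a random erasure pattern `s` with erasure probabilities `p`. -/
def erasureMean (F : (B → Bool) → ℝ) (p : B → ℝ) : ℝ := ∑ s, patternProb p s * F s

lemma sum_patternProb (p : B → ℝ) : ∑ s, patternProb p s = 1 := by
  have := Finset.prod_univ_sum (fun _ : B => (Finset.univ : Finset Bool))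
    (fun b t => if t then 1 - p b else p b)
  simp only [Fintype.piFinset_univ] at this
  simp only [patternProb]
  rw [← this]
  simp

lemma erasureMean_const (c : ℝ) (p : B → ℝ) : erasureMean (fun _ => c) p = c := by
  rw [erasureMean, ← Finset.sum_mul, sum_patternProb, one_mul]

lemma erasureMean_add (F G : (B → Bool) → ℝ) (p : B → ℝ) :
    erasureMean (fun s => F s + G s) p = erasureMean F p + erasureMean G p := by
  simp [erasureMean, mul_add, Finset.sum_add_distrib]

lemma erasureMean_sub (F G : (B → Bool) → ℝ) (p : B → ℝ) :
    erasureMean (fun s => F s - G s) p = erasureMean F p - erasureMean G p := by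
  simp [erasureMean, mul_sub, Finset.sum_sub_distrib]

lemma erasureMean_mul_const (F : (B → Bool) → ℝ) (c : ℝ) (p : B → ℝ) :
    erasureMean (fun s => F s * c) p = erasureMean F p * c := by
  simp [erasureMean, Finset.sum_mul, mul_assoc]

lemma erasureMean_sum {ι : Type*} (t : Finset ι) (F : ι → (B → Bool) → ℝ) (p : B → ℝ) :
    erasureMean (fun s => ∑ i ∈ t, F i s) p = ∑ i ∈ t, erasureMean (F i) p := by
  simp only [erasureMean, Finset.mul_sum]
  exact Finset.sum_comm

lemma erasureMean_le_erasureMean {F G : (B → Bool) → ℝ} {p : B → ℝ} (h0 : ∀ b, 0 ≤ p b)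
    (h1 : ∀ b, p b ≤ 1) (h : ∀ s, F s ≤ G s) : erasureMean F p ≤ erasureMean G p :=
  Finset.sum_le_sum fun s _ => mul_le_mul_of_nonneg_left (h s) (patternProb_nonneg h0 h1 s)

/-- The erasure pattern `s` is split according to its bit `b`. -/
lemma erasureMean_update (F : (B → Bool) → ℝ) (p : B → ℝ) (b : B) (t : ℝ) :
    erasureMean F (update p b t) = t * erasureMean (fun s => F (update s b false)) p +
      (1 - t) * erasureMean (fun s => F (update s b true)) p := by
  let R : (B → Bool) → ℝ := fun s => ∏ c ∈ Finset.univ.erase b, if s c then 1 - p c else p c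
  have hw : ∀ t s, patternProb (update p b t) s = (if s b then 1 - t else t) * R s := by
    intro t s
    rw [patternProb, ← Finset.mul_prod_erase _ _ (Finset.mem_univ b)]
    simp only [update_self, R]
    congr 1
    exact Finset.prod_congr rfl fun c hc => by rw [update_of_ne (Finset.ne_of_mem_erase hc)]
  have hR : ∀ s a, R (update s b a) = R s := fun s a =>
    Finset.prod_congr rfl fun c hc => by rw [update_of_ne (Finset.ne_of_mem_erase hc)]
  -- Flipping bit `b` is a bijection that preserves `R`, so sums over patterns with `b` erased
  -- become sums over patterns with `b` known.
  have hflip : ∀ G : (B → Bool) → ℝ, ∑ s, G (update s b (!s b)) = ∑ s, G s := by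
    intro G
    have hinv : Involutive fun s : B → Bool => update s b (!s b) := by
      intro s; simp
    exact Equiv.sum_comp hinv.toPerm G
  have hsplit : ∀ t G, erasureMean G (update p b t) =
      ∑ s, R s * (if s b then (1 - t) * G (update s b true) else t * G (update s b false)) := by
    intro t G
    refine Finset.sum_congr rfl fun s _ => ?_
    rw [hw]
    by_cases h : s b
    · have : update s b true = s := by rw [← h, update_eq_self]
      simp only [h, if_true, this]; ring
    · have : update s b false = s := by
        rw [Bool.not_eq_true] at h
        rw [← h, update_eq_self]
      simp only [h, this]; simp; ring
  have hind : ∀ t (a : Bool), erasureMean (fun s => F (update s b a)) (update p b t) =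
      ∑ s, R s * (if s b then F (update s b a) else 0) := by
    intro t a
    rw [hsplit]
    simp only [update_idem]
    have e1 : ∀ s, R s * (if s b = true then (1 - t) * F (update s b a) else t * F (update s b a))
        = (1 - t) * (R s * if s b then F (update s b a) else 0) +
          t * (R s * if s b then 0 else F (update s b a)) := by
      intro s; split_ifs <;> ring
    rw [Finset.sum_congr rfl fun s _ => e1 s, Finset.sum_add_distrib, ← Finset.mul_sum,
      ← Finset.mul_sum, ← hflip fun s => R s * if s b then 0 else F (update s b a)]
    simp only [hR, update_self, update_idem]
    have e2 : ∀ s, (R s * if (!s b) = true then 0 else F (update s b a)) =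
        R s * if s b then F (update s b a) else 0 := by
      intro s; cases s b <;> simp
    rw [Finset.sum_congr rfl fun s _ => e2 s]
    ring
  have hp : ∀ a : Bool, erasureMean (fun s => F (update s b a)) p =
      ∑ s, R s * (if s b then F (update s b a) else 0) := by
    intro a
    have := hind (p b) a
    rwa [update_eq_self] at this
  rw [hp, hp, hsplit]
  have e3 : ∀ s, R s * (if s b = true then (1 - t) * F (update s b true)
        else t * F (update s b false)) = (1 - t) * (R s * if s b then F (update s b true) else 0) +
          t * (R s * if s b then 0 else F (update s b false)) := by
    intro s; split_ifs <;> ring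
  rw [Finset.sum_congr rfl fun s _ => e3 s, Finset.sum_add_distrib, ← Finset.mul_sum,
      ← Finset.mul_sum, ← hflip fun s => R s * if s b then 0 else F (update s b false)]
  simp only [hR, update_self, update_idem]
  have e2 : ∀ s, (R s * if (!s b) = true then 0 else F (update s b false)) =
        R s * if s b then F (update s b false) else 0 := by
      intro s; cases s b <;> simp
  rw [Finset.sum_congr rfl fun s _ => e2 s]
  ring

lemma erasureMean_indicator (p : B → ℝ) (b : B) :
    erasureMean (fun s => if s b then 0 else 1) p = p b := by
  have := erasureMean_update (fun s : B → Bool => if s b then (0 : ℝ) else 1) p b (p b)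
  rw [update_eq_self] at this
  simpa [erasureMean_const] using this

/-- Erasing more increases the mean of a function which decreases with the known bits. -/
theorem erasureMean_mono {F : (B → Bool) → ℝ}
    (hF : ∀ b s, F (update s b true) ≤ F (update s b false)) {p q : B → ℝ}
    (h0 : ∀ b, 0 ≤ p b) (hpq : ∀ b, p b ≤ q b) (h1 : ∀ b, q b ≤ 1) :
    erasureMean F p ≤ erasureMean F q := by
  suffices ∀ A : Finset B, erasureMean F p ≤ erasureMean F (A.piecewise q p) by
    simpa using this Finset.univ
  intro A
  induction A using Finset.induction_on with
  | empty => simp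
  | insert b A hb ih =>
    refine ih.trans ?_
    rw [Finset.piecewise_insert]
    have e : erasureMean F (A.piecewise q p) =
        erasureMean F (update (A.piecewise q p) b (p b)) := by
      congr 1
      rw [eq_update_iff]
      simp [hb]
    rw [e, erasureMean_update, erasureMean_update F _ b (q b)]
    have hle : erasureMean (fun s => F (update s b true)) (A.piecewise q p) ≤
        erasureMean (fun s => F (update s b false)) (A.piecewise q p) := by
      refine erasureMean_le_erasureMean (fun c => ?_) (fun c => ?_) (hF b)
      · by_cases hc : c ∈ A <;> simp [hc, h0, (h0 c).trans (hpq c)]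
      · by_cases hc : c ∈ A <;> simp [hc, h1, (hpq c).trans (h1 c)]
    nlinarith [mul_nonneg (sub_nonneg.2 (hpq b)) (sub_nonneg.2 hle)]

/-- The multilinear extension of a submodular function is concave along nonnegative
directions. -/
theorem erasureMean_concave {F : (B → Bool) → ℝ}
    (hF : ∀ b c s, F (update (update s c false) b false) - F (update (update s c false) b true) ≤
      F (update (update s c true) b false) - F (update (update s c true) b true))
    {y z : B → ℝ} (h0 : ∀ b, 0 ≤ y b) (hyz : ∀ b, y b ≤ z b) (h1 : ∀ b, z b ≤ 1)
    {t : ℝ} (ht0 : 0 ≤ t) (ht1 : t ≤ 1) :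
    t * erasureMean F z + (1 - t) * erasureMean F y ≤
      erasureMean F (fun b => t * z b + (1 - t) * y b) := by
  -- `p` must vary in the induction: conditioning on bit `b` sets `p b` to 1 or to 0.
  suffices ∀ (A : Finset B) (p : B → ℝ), (∀ b, 0 ≤ p b) → (∀ b, p b ≤ 1) →
      t * erasureMean F (A.piecewise z p) + (1 - t) * erasureMean F (A.piecewise y p) ≤
        erasureMean F (A.piecewise (fun b => t * z b + (1 - t) * y b) p) by
    simpa using this Finset.univ y h0 fun b => (hyz b).trans (h1 b)
  intro A
  induction A using Finset.induction_on with
  | empty => intro p _ _; simp; linarith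
  | insert b A hb ih =>
    intro p hp0 hp1
    have hsp : ∀ x : B → ℝ, erasureMean F ((insert b A).piecewise x p) =
        x b * erasureMean F (A.piecewise x (update p b 1)) +
          (1 - x b) * erasureMean F (A.piecewise x (update p b 0)) := by
      intro x
      rw [Finset.piecewise_insert, ← Finset.update_piecewise_of_notMem _ _ _ hb,
        ← Finset.update_piecewise_of_notMem _ _ _ hb, erasureMean_update,
        erasureMean_update F _ b 1, erasureMean_update F _ b 0]
      ring
    have hdiff : ∀ x : B → ℝ, erasureMean F (A.piecewise x (update p b 1)) -
        erasureMean F (A.piecewise x (update p b 0)) =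
        -erasureMean (fun s => F (update s b true) - F (update s b false)) (A.piecewise x p) := by
      intro x
      rw [← Finset.update_piecewise_of_notMem _ _ _ hb,
        ← Finset.update_piecewise_of_notMem _ _ _ hb,
        erasureMean_update F _ b 1, erasureMean_update F _ b 0, erasureMean_sub]
      ring
    have hD : erasureMean (fun s => F (update s b true) - F (update s b false)) (A.piecewise y p) ≤
        erasureMean (fun s => F (update s b true) - F (update s b false)) (A.piecewise z p) := by
      refine erasureMean_mono (fun c s => ?_) (fun c => ?_) (fun c => ?_) fun c => ?_
      · linarith [hF b c s]
      · by_cases hc : c ∈ A <;> simp [hc, h0, hp0]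
      · by_cases hc : c ∈ A <;> simp [hc, hyz]
      · by_cases hc : c ∈ A <;> simp [hc, h1, hp1]
    have i1 := ih (update p b 1)
      (fun c => by by_cases hc : c = b <;> [subst hc; skip] <;> simp [*])
      (fun c => by by_cases hc : c = b <;> [subst hc; skip] <;> simp [*])
    have i0 := ih (update p b 0)
      (fun c => by by_cases hc : c = b <;> [subst hc; skip] <;> simp [*])
      (fun c => by by_cases hc : c = b <;> [subst hc; skip] <;> simp [*])
    have hy := hdiff y
    have hz := hdiff z
    rw [hsp, hsp, hsp]
    set x : B → ℝ := fun b => t * z b + (1 - t) * y b with hx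
    have hxb : x b = t * z b + (1 - t) * y b := rfl
    have hyb := h0 b
    have hzb := h1 b
    have hyzb := hyz b
    have hx0 : 0 ≤ x b := by rw [hxb]; nlinarith
    have hx1 : x b ≤ 1 := by rw [hxb]; nlinarith
    have j1 := mul_le_mul_of_nonneg_left i1 hx0
    have j0 := mul_le_mul_of_nonneg_left i0 (sub_nonneg.2 hx1)
    -- This product is what the chord loses in coordinate `b`. Its last factor is the drop of the
    -- slope in `b` from `y` to `z`, nonnegative by submodularity.
    have j2 : 0 ≤ (t * (1 - t) * (z b - y b)) *
        ((erasureMean F (A.piecewise y (update p b 1)) -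
        erasureMean F (A.piecewise y (update p b 0))) -
        (erasureMean F (A.piecewise z (update p b 1)) -
        erasureMean F (A.piecewise z (update p b 0)))) :=
      mul_nonneg (mul_nonneg (mul_nonneg ht0 (by linarith)) (by linarith)) (by linarith)
    rw [hxb] at j1 j0
    linarith

/-- Erasure probability `0` on `A` means that the bits in `A` are known. -/
lemma erasureMean_piecewise_zero (F : (B → Bool) → ℝ) (p : B → ℝ) (A : Finset B) :
    erasureMean F (A.piecewise 0 p) = erasureMean (fun s => F (A.piecewise (fun _ => true) s)) p := by
  induction A using Finset.induction_on generalizing F with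
  | empty => simp
  | insert b A hb ih =>
    rw [Finset.piecewise_insert, erasureMean_update]
    simp only [Pi.zero_apply, zero_mul, zero_add, sub_zero, one_mul]
    rw [ih]
    simp only [Finset.piecewise_insert]

lemma erasureMean_split (A : Finset B) (F G : (B → Bool) → ℝ) (c : ℝ) (p : B → ℝ) :
    erasureMean (fun s => ((∑ b ∈ A, if s b then (0 : ℝ) else 1) * c - G s) +
        F (A.piecewise (fun _ => true) s)) p =
      (∑ b ∈ A, p b) * c - erasureMean G p + erasureMean F (A.piecewise 0 p) := by
  rw [erasureMean_add, erasureMean_sub, erasureMean_mul_const, erasureMean_sum,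
    ← erasureMean_piecewise_zero, Finset.sum_congr rfl fun b _ => erasureMean_indicator p b]

end Multilinear

/-! ### Sums over products -/

section Marginal

variable {ι : Type*} [Fintype ι] [DecidableEq ι] {A : ι → Type*} [∀ i, Fintype (A i)]

lemma sum_pi_mul_apply (p : ∀ i, A i → ℝ) (i₀ : ι) (hp : ∀ i, i ≠ i₀ → ∑ a, p i a = 1)
    (φ : A i₀ → ℝ) : ∑ g : ∀ i, A i, (∏ i, p i (g i)) * φ (g i₀) = ∑ a, p i₀ a * φ a := by
  rw [← Equiv.sum_comp (Equiv.piSplitAt i₀ A).symm, Fintype.sum_prod_type]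
  refine Finset.sum_congr rfl fun a _ => ?_
  have e : ∀ g : ∀ j : {j // j ≠ i₀}, A j,
      (∏ i, p i ((Equiv.piSplitAt i₀ A).symm (a, g) i)) =
        p i₀ a * ∏ j : {j // j ≠ i₀}, p j (g j) := by
    intro g
    rw [Fintype.prod_eq_mul_prod_subtype_ne _ i₀]
    congr 1
    · simp [Equiv.piSplitAt]
    · refine Finset.prod_congr rfl fun j _ => ?_
      simp [Equiv.piSplitAt, j.2]
  have e2 : ∀ g : ∀ j : {j // j ≠ i₀}, A j, (Equiv.piSplitAt i₀ A).symm (a, g) i₀ = a := by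
    intro g; simp [Equiv.piSplitAt]
  simp only [e, e2]
  have h1 : ∑ g : ∀ j : {j // j ≠ i₀}, A j, ∏ j : {j // j ≠ i₀}, p j (g j) = 1 := by
    have := Finset.prod_univ_sum (fun j : {j // j ≠ i₀} => (Finset.univ : Finset (A j)))
      (fun j a => p j a)
    rw [Fintype.piFinset_univ] at this
    rw [← this]
    exact Finset.prod_eq_one fun j _ => hp j j.2
  rw [← Finset.sum_mul, ← Finset.mul_sum, h1, mul_one]

/-- Erasure patterns also cover a user's own message, on which it has no state; this lemma
integrates that factor out. -/
lemma sum_pi_mul_restrict (p : ∀ i, A i → ℝ) (i₀ : ι) (hp : ∑ a, p i₀ a = 1)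
    (ψ : (∀ j : {j // j ≠ i₀}, A j) → ℝ) :
    ∑ s : ∀ i, A i, (∏ i, p i (s i)) * ψ (fun j => s j) =
      ∑ g : ∀ j : {j // j ≠ i₀}, A j, (∏ j : {j // j ≠ i₀}, p j (g j)) * ψ g := by
  rw [← Equiv.sum_comp (Equiv.piSplitAt i₀ A).symm, Fintype.sum_prod_type, Finset.sum_comm]
  refine Finset.sum_congr rfl fun g _ => ?_
  have e : ∀ a : A i₀, (∏ i, p i ((Equiv.piSplitAt i₀ A).symm (a, g) i)) =
        p i₀ a * ∏ j : {j // j ≠ i₀}, p j (g j) := by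
    intro a
    rw [Fintype.prod_eq_mul_prod_subtype_ne _ i₀]
    congr 1
    · simp [Equiv.piSplitAt]
    · refine Finset.prod_congr rfl fun j _ => ?_
      simp [Equiv.piSplitAt, j.2]
  have e2 : ∀ a : A i₀, (fun j : {j // j ≠ i₀} => (Equiv.piSplitAt i₀ A).symm (a, g) j) = g := by
    intro a; funext j; simp [Equiv.piSplitAt, j.2]
  simp only [e, e2]
  rw [← Finset.sum_mul, ← Finset.sum_mul, hp, one_mul]

end Marginal

/-! ### Entropy of the channel input of a scheme -/

section Scheme

open Function

variable {K n : ℕ}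

/-- The message bits with known positions `s`. -/
def reveal {m : Fin K → ℕ} (s : (Σ j, Fin (m j)) → Bool) (w : Messages m) :
    (Σ j, Fin (m j)) → Bool := fun b => s b && w b.1 b.2

lemma reveal_eq_iff {m : Fin K → ℕ} {s : (Σ j, Fin (m j)) → Bool} {u w : Messages m} :
    reveal s u = reveal s w ↔ ∀ b, s b = true → u b.1 b.2 = w b.1 b.2 := by
  constructor
  · intro h b hb
    simpa [reveal, hb] using congrFun h b
  · intro h
    funext b
    by_cases hb : s b = true
    · simp [reveal, hb, h b hb]
    · simp [reveal, hb]

/-- The mean log-number of messages which are consistent with the channel input and the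
message bits at the positions `s`. -/
def obsLog (S : Scheme K n) (s : (Σ j, Fin (S.m j)) → Bool) : ℝ :=
  meanLog fun w : Messages S.m => (S.enc w, reveal s w)

/-- The entropy of the channel input given the message bits at the positions `s`. -/
def inputEntropy (S : Scheme K n) (s : (Σ j, Fin (S.m j)) → Bool) : ℝ :=
  (∑ b, if s b then (0 : ℝ) else 1) * Real.log 2 - obsLog S s

/-- All bits of message `i`. -/
def ownBits (S : Scheme K n) (i : Fin K) : (Σ j, Fin (S.m j)) → Bool := fun b => decide (b.1 = i)

/-- The entropy of message `i` given the channel input and the message bits at the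
positions `s`. -/
def equivocation (S : Scheme K n) (i : Fin K) (s : (Σ j, Fin (S.m j)) → Bool) : ℝ :=
  obsLog S s - obsLog S (s ⊔ ownBits S i)

-- Monotonicity and submodularity of the conditional entropies

lemma obsLog_sup (S : Scheme K n) (s a : (Σ j, Fin (S.m j)) → Bool) :
    obsLog S (s ⊔ a) = meanLog fun w => (reveal a w, (S.enc w, reveal s w)) := by
  refine meanLog_congr fun u w => ?_
  simp only [Prod.mk.injEq, reveal_eq_iff, Pi.sup_apply]
  constructor
  · rintro ⟨h1, h2⟩
    exact ⟨fun b hb => h2 b (by simp [hb]), h1, fun b hb => h2 b (by simp [hb])⟩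
  · rintro ⟨h1, h2, h3⟩
    refine ⟨h2, fun b hb => ?_⟩
    cases hs : s b
    · exact h1 b (by simpa [hs] using hb)
    · exact h3 b hs

/-- Each side is the entropy of the bits at `a` given the channel input and the known bits; knowing
more can only lower it. -/
lemma obsLog_diff_antitone (S : Scheme K n) (a : (Σ j, Fin (S.m j)) → Bool)
    {s s' : (Σ j, Fin (S.m j)) → Bool} (h : s ≤ s') :
    obsLog S s' - obsLog S (s' ⊔ a) ≤ obsLog S s - obsLog S (s ⊔ a) := by
  have e1 : obsLog S s' = meanLog fun w => (reveal s' w, (S.enc w, reveal s w)) := by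
    rw [← obsLog_sup, sup_eq_right.2 h]
  have e2 : obsLog S (s' ⊔ a) =
      meanLog fun w => (reveal a w, (reveal s' w, (S.enc w, reveal s w))) := by
    rw [obsLog_sup]
    refine meanLog_congr fun u w => ?_
    simp only [Prod.mk.injEq, reveal_eq_iff]
    refine ⟨fun ⟨h1, h2, h3⟩ => ⟨h1, h3, h2, fun b hb => h3 b ?_⟩,
      fun ⟨h1, h2, h3, _⟩ => ⟨h1, h3, h2⟩⟩
    have := h b
    rw [hb] at this
    exact top_le_iff.1 this
  rw [e1, e2, obsLog_sup]
  exact meanLog_cond_le _ _ _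

lemma update_true_eq_sup {B : Type*} [DecidableEq B] (s : B → Bool) (b : B) :
    update s b true = update s b false ⊔ fun c => decide (c = b) := by
  funext c
  by_cases h : c = b
  · subst h; simp
  · simp [h]

lemma obsLog_sub_update_le (S : Scheme K n) (s : (Σ j, Fin (S.m j)) → Bool)
    (b : Σ j, Fin (S.m j)) :
    obsLog S (update s b false) - obsLog S (update s b true) ≤ Real.log 2 := by
  have e : obsLog S (update s b true) =
      meanLog fun w => (w b.1 b.2, (S.enc w, reveal (update s b false) w)) := by
    rw [update_true_eq_sup, obsLog_sup]
    refine meanLog_congr fun u w => ?_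
    simp [reveal_eq_iff]
  rw [e]
  exact (meanLog_sub_le_log_card _ _).trans (by simp)

/-- The mutual information of X and bit `b` given the other known bits: `b` is uniform a priori,
hence log 2 minus what remains uncertain once X is seen. -/
lemma inputEntropy_sub_update (S : Scheme K n) (s : (Σ j, Fin (S.m j)) → Bool)
    (b : Σ j, Fin (S.m j)) :
    inputEntropy S (update s b false) - inputEntropy S (update s b true) =
      Real.log 2 - (obsLog S (update s b false) - obsLog S (update s b true)) := by
  have e : ∀ t : Bool, (∑ c, if update s b t c then (0 : ℝ) else 1) =
      (if t then 0 else 1) + ∑ c ∈ Finset.univ.erase b, if s c then (0 : ℝ) else 1 := by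
    intro t
    rw [← Finset.add_sum_erase _ _ (Finset.mem_univ b), update_self]
    congr 1
    exact Finset.sum_congr rfl fun c hc => by rw [update_of_ne (Finset.ne_of_mem_erase hc)]
  rw [inputEntropy, inputEntropy, e, e]
  simp
  ring

lemma inputEntropy_update_le (S : Scheme K n) (b : Σ j, Fin (S.m j))
    (s : (Σ j, Fin (S.m j)) → Bool) :
    inputEntropy S (update s b true) ≤ inputEntropy S (update s b false) := by
  linarith [inputEntropy_sub_update S s b, obsLog_sub_update_le S s b]

/-- Learning bit `c` leaves the prior uncertainty about an independent bit `b` unchanged but lowers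
the uncertainty after seeing X, so X tells more about `b`. -/
lemma inputEntropy_submodular (S : Scheme K n) (b c : Σ j, Fin (S.m j))
    (s : (Σ j, Fin (S.m j)) → Bool) :
    inputEntropy S (update (update s c false) b false) -
        inputEntropy S (update (update s c false) b true) ≤
      inputEntropy S (update (update s c true) b false) -
        inputEntropy S (update (update s c true) b true) := by
  rw [inputEntropy_sub_update, inputEntropy_sub_update, update_true_eq_sup _ b,
    update_true_eq_sup _ b]
  have := obsLog_diff_antitone S (fun d => decide (d = b))
    (s := update (update s c false) b false) (s' := update (update s c true) b false) (by
      refine update_le_update_iff.2 ⟨le_rfl, fun d _ => ?_⟩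
      by_cases h : d = c
      · subst h; simp
      · simp [h])
  linarith

lemma equivocation_update_le (S : Scheme K n) (i : Fin K) (b : Σ j, Fin (S.m j))
    (s : (Σ j, Fin (S.m j)) → Bool) :
    equivocation S i (update s b true) ≤ equivocation S i (update s b false) :=
  obsLog_diff_antitone S _ (update_le_update_iff.2 ⟨by simp, fun _ _ => le_rfl⟩)

/-- Chain rule for I(X; W_i | known bits), expanded in both orders. -/
lemma inputEntropy_eq (S : Scheme K n) (i : Fin K) (s : (Σ j, Fin (S.m j)) → Bool) :
    inputEntropy S s =
      ((∑ b ∈ Finset.univ.filter fun b : Σ j, Fin (S.m j) => b.1 = i,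
        if s b then (0 : ℝ) else 1) * Real.log 2 - equivocation S i s) +
        inputEntropy S ((Finset.univ.filter fun b : Σ j, Fin (S.m j) => b.1 = i).piecewise
          (fun _ => true) s) := by
  have e : (Finset.univ.filter fun b : Σ j, Fin (S.m j) => b.1 = i).piecewise
          (fun _ => true) s = s ⊔ ownBits S i := by
    funext b
    by_cases h : b.1 = i <;> simp [ownBits, h]
  have e2 : (∑ b, if s b then (0 : ℝ) else 1) =
      (∑ b ∈ Finset.univ.filter fun b : Σ j, Fin (S.m j) => b.1 = i, if s b then (0 : ℝ) else 1) +
        ∑ b, if (s ⊔ ownBits S i) b then (0 : ℝ) else 1 := by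
    rw [Finset.sum_filter, ← Finset.sum_add_distrib]
    refine Finset.sum_congr rfl fun b _ => ?_
    by_cases h : b.1 = i <;> simp [ownBits, h]
  rw [e, inputEntropy, inputEntropy, equivocation, e2]
  ring

lemma inputEntropy_of_known (S : Scheme K n) : inputEntropy S (fun _ => true) = 0 := by
  have : ∀ w, fiberCard (fun w : Messages S.m => (S.enc w, reveal (fun _ => true) w)) w = 1 := by
    intro w
    rw [fiberCard, Finset.card_eq_one]
    refine ⟨w, ?_⟩
    ext u
    simp only [Finset.mem_filter, Finset.mem_univ, true_and, Finset.mem_singleton, Prod.mk.injEq,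
      reveal_eq_iff]
    constructor
    · rintro ⟨-, h⟩
      funext j l
      exact h ⟨j, l⟩ trivial
    · rintro rfl
      simp
  simp [inputEntropy, obsLog, meanLog, this]

lemma inputEntropy_le_of_unknown (S : Scheme K n) :
    inputEntropy S (fun _ => false) ≤ n * Real.log 2 := by
  have h1 : meanLog (fun _ : Messages S.m => ()) =
      (∑ b : Σ j, Fin (S.m j), (1 : ℝ)) * Real.log 2 := by
    have h2 : Fintype.card (Messages S.m) = 2 ^ Fintype.card (Σ j, Fin (S.m j)) := by
      simp [Messages, Fintype.card_pi, Finset.prod_pow_eq_pow_sum]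
    have h3 : ∀ w, fiberCard (fun _ : Messages S.m => ()) w = Fintype.card (Messages S.m) := by
      intro w; simp [fiberCard]
    have h4 : (Fintype.card (Messages S.m) : ℝ) ≠ 0 := by
      exact_mod_cast Fintype.card_ne_zero
    simp only [meanLog, h3, Finset.sum_const, Finset.card_univ, nsmul_eq_mul]
    rw [mul_div_cancel_left₀ _ h4, h2]
    push_cast
    rw [Real.log_pow]
    simp
  have h5 : obsLog S (fun _ => false) = meanLog fun w => (S.enc w, ()) :=
    meanLog_congr fun u w => by simp [reveal_eq_iff]
  have h6 := meanLog_sub_le_log_card S.enc (fun _ : Messages S.m => ())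
  rw [inputEntropy, h5]
  simp only [Bool.false_eq_true, if_false]
  rw [← h1]
  refine h6.trans (le_of_eq ?_)
  simp

-- Fano's inequality averaged over the side information

/-- The error probability of user `i` for given side information states. -/
def condError (S : Scheme K n) (i : Fin K)
    (g : ∀ j : {j : Fin K // j ≠ i}, Fin (S.m j) → Bool) : ℝ :=
  (∑ w : Messages S.m,
    if S.dec i (S.enc w) (fun j => (fun l => g j l && w j l, g j)) ≠ w i then (1 : ℝ) else 0) /
    Fintype.card (Messages S.m)

/-- Fano's inequality for the decoder of user `i` run with states `s`; the positions of `s` in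
message `i` are not read by it. -/
lemma equivocation_le (S : Scheme K n) (i : Fin K) (s : (Σ j, Fin (S.m j)) → Bool) :
    equivocation S i s ≤
      Real.log 2 + condError S i (fun j l => s ⟨j, l⟩) * (S.m i * Real.log 2) := by
  have e : obsLog S (s ⊔ ownBits S i) =
      meanLog fun w => (w i, (S.enc w, reveal s w)) := by
    rw [obsLog_sup]
    refine meanLog_congr fun u w => ?_
    simp only [Prod.mk.injEq, reveal_eq_iff]
    refine and_congr ⟨fun h => ?_, fun h b hb => ?_⟩ Iff.rfl
    · funext l
      exact h ⟨i, l⟩ (by simp [ownBits])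
    · obtain ⟨j, l⟩ := b
      have : j = i := by simpa [ownBits] using hb
      subst this
      exact congrFun h l
  rw [equivocation, e]
  refine (meanLog_sub_le_fano (fun w : Messages S.m => w i) (fun w => (S.enc w, reveal s w))
    (fun c => S.dec i c.1 (fun j => (fun l => c.2 ⟨j, l⟩, fun l => s ⟨j, l⟩)))).trans ?_
  refine le_of_eq ?_
  congr 2
  · rw [condError]
    congr!
  · simp

/-- The erasure probabilities of user `i`. -/
def userErasure (μ : Fin K → Fin K → ℝ) (i j : Fin K) : ℝ := if j = i then 1 else μ i j

/-- The estimate of user `i` depends on the states only through its own ones, so those of all other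
users sum out. -/
lemma erasureMean_condError (μ : Fin K → Fin K → ℝ) (S : Scheme K n) (i : Fin K) :
    erasureMean (fun s : (Σ j, Fin (S.m j)) → Bool => condError S i fun j l => s ⟨j, l⟩)
      (fun b => userErasure μ i b.1) =
      S.errorProb μ i := by
  let P : ∀ i : Fin K, (∀ j : {j : Fin K // j ≠ i}, Fin (S.m j) → Bool) → ℝ := fun i g =>
    ∏ j : {j : Fin K // j ≠ i}, ∏ l : Fin (S.m j), (if g j l then 1 - μ i j else μ i j)
  have hP : ∀ i, ∑ g, P i g = 1 := by
    intro i
    have := Finset.prod_univ_sum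
      (fun j : {j : Fin K // j ≠ i} => (Finset.univ : Finset (Fin (S.m j) → Bool)))
      (fun j g => ∏ l, (if g l then 1 - μ i j else μ i j))
    rw [Fintype.piFinset_univ] at this
    simp only [P]
    rw [← this]
    exact Finset.prod_eq_one fun j _ => sum_patternProb (fun _ => μ i j)
  trans ∑ g, P i g * condError S i g
  · rw [erasureMean, ← Equiv.sum_comp (Equiv.piCurry (fun j (_ : Fin (S.m j)) => Bool)).symm]
    have := sum_pi_mul_restrict (A := fun j => Fin (S.m j) → Bool)
      (fun j s => ∏ l, (if s l then 1 - userErasure μ i j else userErasure μ i j)) i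
      (sum_patternProb (fun _ => userErasure μ i i)) (condError S i)
    refine Eq.trans ?_ (this.trans ?_)
    · refine Finset.sum_congr rfl fun s _ => ?_
      congr 1
      rw [patternProb, Fintype.prod_sigma]
      rfl
    · refine Finset.sum_congr rfl fun g _ => ?_
      congr 1
      refine Finset.prod_congr rfl fun j _ => ?_
      simp [userErasure, j.2]
  · have := sum_pi_mul_apply P i (fun i' _ => hP i') (condError S i)
    rw [← this, Scheme.errorProb, Finset.sum_comm]
    refine Finset.sum_congr rfl fun g _ => ?_
    have hc : (Fintype.card (Messages S.m) : ℝ)⁻¹ = ∏ j : Fin K, (1 / 2 : ℝ) ^ S.m j := by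
      simp [Messages, Fintype.card_pi]
    rw [condError, div_eq_mul_inv, hc, Finset.sum_mul, Finset.mul_sum]
    refine Finset.sum_congr rfl fun w _ => ?_
    have hd : S.dec i (S.enc w) (fun j => (fun l => g i j l && w j l, g i j)) =
      S.estimate w g i := rfl
    rw [hd]
    by_cases h : S.estimate w g i = w i
    · simp [h]
    · simp only [ne_eq, h, not_false_eq_true, if_true, outcomeProb, P]
      ring

-- Inequalities for the entropy under an erasure profile

/-- The entropy of the channel input, given that all bits of message `j` are erased with
probability `η j` and are known otherwise. -/
def channelEntropy (S : Scheme K n) (η : Fin K → ℝ) : ℝ :=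
  erasureMean (inputEntropy S) fun b => η b.1

lemma channelEntropy_mono (S : Scheme K n) {η η' : Fin K → ℝ} (h0 : ∀ j, 0 ≤ η j)
    (h : ∀ j, η j ≤ η' j) (h1 : ∀ j, η' j ≤ 1) : channelEntropy S η ≤ channelEntropy S η' :=
  erasureMean_mono (inputEntropy_update_le S) (fun b => h0 b.1) (fun b => h b.1) fun b => h1 b.1

lemma channelEntropy_nonneg (S : Scheme K n) {η : Fin K → ℝ} (h0 : ∀ j, 0 ≤ η j)
    (h1 : ∀ j, η j ≤ 1) : 0 ≤ channelEntropy S η := by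
  refine le_trans (le_of_eq ?_) (channelEntropy_mono S (η := 0) (fun _ => le_rfl) h0 h1)
  have := erasureMean_piecewise_zero (inputEntropy S) 0 Finset.univ
  simp only [Finset.piecewise_univ, inputEntropy_of_known, erasureMean_const] at this
  exact this.symm

lemma channelEntropy_le (S : Scheme K n) {η : Fin K → ℝ} (h0 : ∀ j, 0 ≤ η j)
    (h1 : ∀ j, η j ≤ 1) : channelEntropy S η ≤ n * Real.log 2 := by
  have hle : ∀ s, inputEntropy S s ≤ inputEntropy S (fun _ => false) := by
    intro s
    suffices ∀ A : Finset (Σ j, Fin (S.m j)),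
        inputEntropy S s ≤ inputEntropy S (A.piecewise (fun _ => false) s) by
      simpa using this Finset.univ
    intro A
    induction A using Finset.induction_on with
    | empty => simp
    | insert b A hb ih =>
      rw [Finset.piecewise_insert]
      refine ih.trans ?_
      generalize A.piecewise (fun _ => false) s = u
      have := inputEntropy_update_le S b u
      cases h : u b
      · rw [← h, update_eq_self]
      · rwa [← h, update_eq_self] at this
  refine (erasureMean_le_erasureMean (fun b => h0 b.1) (fun b => h1 b.1) hle).trans ?_
  rw [erasureMean_const]
  exact inputEntropy_le_of_unknown S

lemma channelEntropy_concave (S : Scheme K n) {y z : Fin K → ℝ} (h0 : ∀ j, 0 ≤ y j)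
    (hyz : ∀ j, y j ≤ z j) (h1 : ∀ j, z j ≤ 1) {t : ℝ} (ht0 : 0 ≤ t) (ht1 : t ≤ 1) :
    t * channelEntropy S z + (1 - t) * channelEntropy S y ≤
      channelEntropy S (fun j => t * z j + (1 - t) * y j) :=
  erasureMean_concave (inputEntropy_submodular S) (fun b => h0 b.1) (fun b => hyz b.1)
    (fun b => h1 b.1) ht0 ht1

/-- User `i` can decode message `i` from the channel input and side information which is at
least as good as its own. -/
theorem channelEntropy_decode (μ : Fin K → Fin K → ℝ) (S : Scheme K n) (i : Fin K)
    (hμ : ∀ j, j ≠ i → μ i j ≤ 1) {η : Fin K → ℝ} (h0 : ∀ j, 0 ≤ η j) (h1 : ∀ j, η j ≤ 1)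
    (hη : ∀ j, j ≠ i → η j ≤ μ i j) :
    η i * S.m i * Real.log 2 + channelEntropy S (update η i 0) ≤
      channelEntropy S η + (Real.log 2 + S.errorProb μ i * (S.m i * Real.log 2)) := by
  have hu : ∀ j, η j ≤ userErasure μ i j := by
    intro j
    by_cases h : j = i
    · simp [userErasure, h, h1]
    · simp [userErasure, h, hη j h]
  have hu1 : ∀ j, userErasure μ i j ≤ 1 := by
    intro j
    by_cases h : j = i
    · simp [userErasure, h]
    · simp [userErasure, h, hμ j h]
  -- Fano's bound holds for the side information of user `i`; the profile `η` erases less, which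
  -- only lowers the equivocation.
  have hG : erasureMean (equivocation S i) (fun b => η b.1) ≤
      Real.log 2 + S.errorProb μ i * (S.m i * Real.log 2) := by
    have e1 : erasureMean (equivocation S i) (fun b => η b.1) ≤
        erasureMean (equivocation S i) (fun b => userErasure μ i b.1) :=
      erasureMean_mono (equivocation_update_le S i) (fun b => h0 b.1) (fun b => hu b.1)
        fun b => hu1 b.1
    have e2 := erasureMean_le_erasureMean (p := fun b : Σ j, Fin (S.m j) => userErasure μ i b.1)
      (fun b => (h0 b.1).trans (hu b.1)) (fun b => hu1 b.1) (equivocation_le S i)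
    rw [erasureMean_add, erasureMean_const, erasureMean_mul_const, erasureMean_condError] at e2
    exact e1.trans e2
  have hF : channelEntropy S η = ((∑ b ∈ Finset.univ.filter fun b : Σ j, Fin (S.m j) => b.1 = i,
      η b.1) * Real.log 2 - erasureMean (equivocation S i) (fun b => η b.1)) +
      channelEntropy S (update η i 0) := by
    have e := erasureMean_split (Finset.univ.filter fun b : Σ j, Fin (S.m j) => b.1 = i)
      (inputEntropy S) (equivocation S i) (Real.log 2) fun b => η b.1
    refine ((congrArg (fun F => erasureMean F fun b : Σ j, Fin (S.m j) => η b.1)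
      (funext (inputEntropy_eq S i))).trans e).trans ?_
    refine congrArg (fun q => _ + erasureMean (inputEntropy S) q) ?_
    funext b
    by_cases h : b.1 = i <;> simp [h]
  have hs : ∑ b ∈ Finset.univ.filter fun b : Σ j, Fin (S.m j) => b.1 = i, η b.1 =
      η i * S.m i := by
    rw [Finset.sum_filter, Fintype.sum_sigma]
    simp [mul_comm]
  rw [hs] at hF
  linarith

end Scheme

/-! ### The coefficients of an outer bound tree -/

section Tree

open Function

variable {K : ℕ} {μ : Fin K → Fin K → ℝ}

lemma eta_mem_Icc (hμ : ∀ i j : Fin K, i ≠ j → 0 ≤ μ i j ∧ μ i j ≤ 1) (v : ℕ → ℕ → Fin K)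
    (ℓ i : ℕ) (j : Fin K) : 0 ≤ eta μ v ℓ i j ∧ eta μ v ℓ i j ≤ 1 := by
  induction ℓ using Nat.twoStepInduction generalizing i j with
  | zero => simp [eta]
  | one =>
    rw [eta]
    split_ifs with h
    · simp
    · exact hμ _ _ (Ne.symm h)
  | more ℓ _ ih =>
    rw [eta]
    split_ifs with h1 h2 h3
    · simp
    · simp
    · exact ih _ _
    · exact ⟨le_min (hμ _ _ (Ne.symm h3)).1 (ih _ _).1, (min_le_right _ _).trans (ih _ _).2⟩

/-- The condition under which the label of a node can decode; the minimum in `eta` is there to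
ensure it. -/
lemma eta_le_mu (hμ : ∀ i j : Fin K, i ≠ j → 0 ≤ μ i j ∧ μ i j ≤ 1) (v : ℕ → ℕ → Fin K)
    (ℓ i : ℕ) {j : Fin K} (hj : j ≠ v ℓ i) : eta μ v ℓ i j ≤ μ (v ℓ i) j := by
  match ℓ with
  | 0 => simpa [eta] using (hμ _ _ hj.symm).1
  | 1 => simp [eta, hj]
  | ℓ + 2 =>
    rw [eta]
    split_ifs with h1 h2
    · exact absurd h1.1 hj
    · exact (hμ _ _ hj.symm).1
    · exact min_le_left _ _

lemma eta_self_of_odd (v : ℕ → ℕ → Fin K) {ℓ i : ℕ} (hℓ : 1 ≤ ℓ) (hi : Odd i) :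
    eta μ v ℓ i (v ℓ i) = 1 := by
  match ℓ with
  | 1 => simp [eta]
  | ℓ + 2 => simp [eta, hi]

lemma eta_left (v : ℕ → ℕ → Fin K) {ℓ i : ℕ} (hℓ : 1 ≤ ℓ) (hi : 1 ≤ i) (j : Fin K) :
    eta μ v (ℓ + 1) (2 * i - 1) j =
      if j = v (ℓ + 1) (2 * i - 1) then 1 else if j = v ℓ i then 0 else
        min (μ (v (ℓ + 1) (2 * i - 1)) j) (eta μ v ℓ i j) := by
  obtain ⟨ℓ, rfl⟩ : ∃ k, ℓ = k + 1 := ⟨ℓ - 1, by omega⟩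
  have h1 : (2 * i - 1 + 1) / 2 = i := by omega
  have h2 : Odd (2 * i - 1) := ⟨i - 1, by omega⟩
  rw [eta, h1]
  simp only [h2, and_true]
  split_ifs <;> rfl

lemma eta_right (v : ℕ → ℕ → Fin K) {ℓ i : ℕ} (hℓ : 1 ≤ ℓ) (j : Fin K) :
    eta μ v (ℓ + 1) (2 * i) j =
      if j = v ℓ i then 0 else if j = v (ℓ + 1) (2 * i) then eta μ v ℓ i j else
        min (μ (v (ℓ + 1) (2 * i)) j) (eta μ v ℓ i j) := by
  obtain ⟨ℓ, rfl⟩ : ∃ k, ℓ = k + 1 := ⟨ℓ - 1, by omega⟩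
  have h1 : (2 * i + 1) / 2 = i := by omega
  have h2 : ¬ Odd (2 * i) := by simp
  rw [eta, h1]
  simp only [h2, and_false, if_false]

lemma pathIndex_parent {ℓ : ℕ} (i : ℕ) (hℓ : ℓ + 1 < K) :
    (pathIndex K i (ℓ + 1) + 1) / 2 = pathIndex K i ℓ := by
  have : K - 1 - ℓ = (K - 1 - (ℓ + 1)) + 1 := by omega
  rw [pathIndex, pathIndex, this, iterate_succ_apply']

/-- Always descending to the right gives a leaf below any node, so the path condition, stated for
leaves, reaches inner nodes. -/
lemma pathIndex_two_pow_mul (ℓ i : ℕ) :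
    pathIndex K (2 ^ (K - 1 - ℓ) * i) ℓ = i := by
  rw [pathIndex]
  induction K - 1 - ℓ with
  | zero => simp
  | succ k ih =>
    rw [iterate_succ_apply, show (2 ^ (k + 1) * i + 1) / 2 = 2 ^ k * i by
      rw [pow_succ', mul_assoc]; omega, ih]

lemma OuterBoundTree.label_path_ne (T : OuterBoundTree K) {i : ℕ} (hi : 1 ≤ i)
    (hi' : i ≤ 2 ^ (K - 2)) {ℓ ℓ' : ℕ} (h1 : 1 ≤ ℓ) (h2 : ℓ < ℓ') (h3 : ℓ' ≤ K) :
    T.label ℓ (pathIndex K i ℓ) ≠ T.label ℓ' (pathIndex K i ℓ') := fun h =>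
  h2.ne (T.path_injective i hi hi' ⟨h1, by omega⟩ ⟨by omega, h3⟩ h)

lemma OuterBoundTree.label_succ_ne (T : OuterBoundTree K) {ℓ c : ℕ} (hℓ : 1 ≤ ℓ) (hℓK : ℓ + 1 < K)
    (hc : 1 ≤ c) (hc' : c ≤ 2 ^ ℓ) : T.label (ℓ + 1) c ≠ T.label ℓ ((c + 1) / 2) := by
  intro h
  have h1 : 1 ≤ 2 ^ (K - 1 - (ℓ + 1)) * c := Nat.mul_pos (by positivity) hc
  have h2 : 2 ^ (K - 1 - (ℓ + 1)) * c ≤ 2 ^ (K - 2) := by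
    rw [show K - 2 = (K - 1 - (ℓ + 1)) + ℓ by omega, pow_add]
    exact Nat.mul_le_mul_left _ hc'
  have h3 := pathIndex_two_pow_mul (K := K) (ℓ + 1) c
  have h4 := pathIndex_parent (2 ^ (K - 1 - (ℓ + 1)) * c) hℓK
  rw [h3] at h4
  have h5 := T.label_path_ne h1 h2 hℓ (Nat.lt_succ_self ℓ) hℓK.le
  rw [Nat.succ_eq_add_one, h3, ← h4] at h5
  exact h5 h.symm

/-- A label gets the value 0 just below its node. Minima keep it 0, and it is never reset to 1 since
labels do not recur on a path. -/
lemma OuterBoundTree.eta_ancestor (hμ : ∀ i j : Fin K, i ≠ j → 0 ≤ μ i j ∧ μ i j ≤ 1)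
    (T : OuterBoundTree K) {i : ℕ} (hi : 1 ≤ i) (hi' : i ≤ 2 ^ (K - 2)) {ℓ ℓ' : ℕ} (hℓ : ℓ < K)
    (h1 : 1 ≤ ℓ') (h2 : ℓ' < ℓ) :
    eta μ T.label ℓ (pathIndex K i ℓ) (T.label ℓ' (pathIndex K i ℓ')) = 0 := by
  induction ℓ with
  | zero => omega
  | succ ℓ ih =>
    obtain ⟨k, rfl⟩ : ∃ k, ℓ = k + 1 := ⟨ℓ - 1, by omega⟩
    have hne : T.label ℓ' (pathIndex K i ℓ') ≠ T.label (k + 2) (pathIndex K i (k + 2)) :=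
      T.label_path_ne hi hi' h1 h2 hℓ.le
    rw [eta, pathIndex_parent i hℓ]
    simp only [hne, false_and, if_false]
    split_ifs with h
    · rfl
    · rw [ih (by omega) (lt_of_le_of_ne (by omega) ?_)]
      · exact min_eq_right (hμ _ _ hne.symm).1
      · rintro rfl
        exact h rfl

/-- A path has K distinct labels, so every user occurs on it; all but the last two are ancestors of
the node in level K - 1. -/
lemma OuterBoundTree.eta_eq_zero (hμ : ∀ i j : Fin K, i ≠ j → 0 ≤ μ i j ∧ μ i j ≤ 1)
    (T : OuterBoundTree K) {ℓ i : ℕ} (hℓ : ℓ + 1 = K) (hi : 1 ≤ i) (hi' : i ≤ 2 ^ (K - 2))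
    {j : Fin K} (h1 : j ≠ T.label ℓ i) (h2 : j ≠ T.label (ℓ + 1) i) :
    eta μ T.label ℓ i j = 0 := by
  have hp : pathIndex K i ℓ = i := by simp [pathIndex, ← hℓ]
  have hp' : pathIndex K i (ℓ + 1) = i := by
    simp [pathIndex, show K - 1 - (ℓ + 1) = 0 by omega]
  have himg : (Finset.Icc 1 K).image (fun ℓ => T.label ℓ (pathIndex K i ℓ)) = Finset.univ := by
    rw [← Finset.card_eq_iff_eq_univ, Finset.card_image_of_injOn]
    · simp
    · simpa using T.path_injective i hi hi'
  have hj := Finset.mem_univ j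
  rw [← himg, Finset.mem_image] at hj
  obtain ⟨ℓ', hℓ', rfl⟩ := hj
  rw [Finset.mem_Icc] at hℓ'
  have h3 : ℓ' ≠ ℓ := by rintro rfl; exact h1 (by rw [hp])
  have h4 : ℓ' ≠ ℓ + 1 := by rintro rfl; exact h2 (by rw [hp'])
  have := T.eta_ancestor hμ hi hi' (ℓ := ℓ) (by omega) hℓ'.1 (by omega)
  rwa [hp] at this

lemma zeta_mem_Icc (hμ : ∀ i j : Fin K, i ≠ j → 0 ≤ μ i j ∧ μ i j ≤ 1) {v : ℕ → ℕ → Fin K}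
    {ℓ i : ℕ} (hℓ : ℓ + 1 < K) (hne : v (ℓ + 1) (2 * i - 1) ≠ v (ℓ + 1) (2 * i)) :
    0 ≤ zeta μ v ℓ i ∧ zeta μ v ℓ i ≤ 1 := by
  rw [zeta, if_pos hℓ]
  have h1 := hμ _ _ hne.symm
  have h2 := eta_mem_Icc hμ v ℓ i (v (ℓ + 1) (2 * i - 1))
  have h3 := sub_nonneg.2 h1.2
  exact ⟨div_nonneg (le_max_right _ _) h3,
    div_le_one_of_le₀ (max_le (by linarith [h2.2]) h3) h3⟩

/-- The erasure probability of the left label is a mixture with weight `ζ` of the erasure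
probabilities at the two children. -/
lemma zeta_mix (hμ : ∀ i j : Fin K, i ≠ j → 0 ≤ μ i j ∧ μ i j ≤ 1) {v : ℕ → ℕ → Fin K}
    {ℓ i : ℕ} (hℓ : ℓ + 1 < K) (hne : v (ℓ + 1) (2 * i - 1) ≠ v (ℓ + 1) (2 * i)) :
    zeta μ v ℓ i * 1 + (1 - zeta μ v ℓ i) *
      min (μ (v (ℓ + 1) (2 * i)) (v (ℓ + 1) (2 * i - 1))) (eta μ v ℓ i (v (ℓ + 1) (2 * i - 1))) =
      eta μ v ℓ i (v (ℓ + 1) (2 * i - 1)) := by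
  rw [zeta, if_pos hℓ]
  have h1 := hμ _ _ hne.symm
  have h2 := eta_mem_Icc hμ v ℓ i (v (ℓ + 1) (2 * i - 1))
  set e := eta μ v ℓ i (v (ℓ + 1) (2 * i - 1))
  set c := μ (v (ℓ + 1) (2 * i)) (v (ℓ + 1) (2 * i - 1))
  -- If `c = 1` the first case applies, with `ζ = 0`; the second has `c < e ≤ 1`, so no division by
  -- zero occurs.
  rcases le_or_gt e c with h | h
  · rw [min_eq_right h, max_eq_right (by linarith)]
    simp
  · have hc : 1 - c ≠ 0 := by
      have := h2.2
      intro h0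
      linarith
    rw [min_eq_left h.le, max_eq_left (by linarith)]
    field_simp
    ring

-- Induction along the outer bound tree

variable {n : ℕ}

lemma channelEntropy_branch (hμ : ∀ i j : Fin K, i ≠ j → 0 ≤ μ i j ∧ μ i j ≤ 1)
    (T : OuterBoundTree K) (S : Scheme K n) {ℓ i : ℕ} (hℓ : 1 ≤ ℓ) (hℓK : ℓ + 1 < K)
    (hi : 1 ≤ i) (hi' : i ≤ 2 ^ (ℓ - 1)) :
    zeta μ T.label ℓ i * channelEntropy S (eta μ T.label (ℓ + 1) (2 * i - 1)) +
        (1 - zeta μ T.label ℓ i) * channelEntropy S (eta μ T.label (ℓ + 1) (2 * i)) ≤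
      channelEntropy S (update (eta μ T.label ℓ i) (T.label ℓ i) 0) := by
  have hab := T.siblings_ne ℓ i hℓ hℓK hi hi'
  have h2i : 2 * i ≤ 2 ^ ℓ := by
    obtain ⟨k, rfl⟩ : ∃ k, ℓ = k + 1 := ⟨ℓ - 1, by omega⟩
    rw [pow_succ']
    exact Nat.mul_le_mul_left 2 hi'
  have hav := T.label_succ_ne (c := 2 * i - 1) hℓ hℓK (by omega) (by omega)
  have hbv := T.label_succ_ne (c := 2 * i) hℓ hℓK (by omega) h2i
  rw [show (2 * i - 1 + 1) / 2 = i by omega] at hav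
  rw [show (2 * i + 1) / 2 = i by omega] at hbv
  have hζ := zeta_mem_Icc hμ hℓK hab
  have hmix := zeta_mix hμ hℓK hab
  have hη := eta_mem_Icc hμ T.label ℓ i
  have hL := eta_mem_Icc hμ T.label (ℓ + 1) (2 * i - 1)
  have hR := eta_mem_Icc hμ T.label (ℓ + 1) (2 * i)
  set a := T.label (ℓ + 1) (2 * i - 1) with ha
  set b := T.label (ℓ + 1) (2 * i) with hb
  set η' := update (eta μ T.label ℓ i) (T.label ℓ i) 0 with hη'
  -- `y` and `z` differ only in coordinate `a`, where they take the values of the right and the left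
  -- child. They dominate the children's profiles, and their mixture with weight `ζ` is `η'`.
  set y := update η' a (min (μ b a) (eta μ T.label ℓ i a)) with hy
  set z := update η' a 1 with hz
  have hη'01 : ∀ j, 0 ≤ η' j ∧ η' j ≤ 1 := by
    intro j
    rw [hη', update_apply]
    split_ifs
    · simp
    · exact hη j
  have hy0 : ∀ j, 0 ≤ y j := by
    intro j
    rw [hy, update_apply]
    split_ifs
    · exact le_min (hμ _ _ hab.symm).1 (hη a).1
    · exact (hη'01 j).1
  have hz1 : ∀ j, z j ≤ 1 := by
    intro j
    rw [hz, update_apply]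
    split_ifs
    · exact le_rfl
    · exact (hη'01 j).2
  have hyz : ∀ j, y j ≤ z j := by
    intro j
    rw [hy, hz, update_apply, update_apply]
    split_ifs
    · exact (min_le_right _ _).trans (hη a).2
    · exact le_rfl
  have hmixη : (fun j => zeta μ T.label ℓ i * z j + (1 - zeta μ T.label ℓ i) * y j) = η' := by
    funext j
    rw [hy, hz, update_apply, update_apply]
    split_ifs with h
    · rw [hmix, h, hη', update_of_ne hav]
    · ring
  have hconc := channelEntropy_concave S hy0 hyz hz1 hζ.1 hζ.2
  rw [hmixη] at hconc
  have hleft : channelEntropy S (eta μ T.label (ℓ + 1) (2 * i - 1)) ≤ channelEntropy S z := by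
    refine channelEntropy_mono S (fun j => (hL j).1) (fun j => ?_) hz1
    rw [eta_left _ hℓ hi, hz, hη', update_apply, update_apply]
    split_ifs with h1 h2
    · exact le_rfl
    · exact le_rfl
    · exact min_le_right _ _
  have hright : channelEntropy S (eta μ T.label (ℓ + 1) (2 * i)) ≤ channelEntropy S y := by
    refine channelEntropy_mono S (fun j => (hR j).1) (fun j => ?_) fun j => (hyz j).trans (hz1 j)
    rw [eta_right _ hℓ, hy, hη', update_apply, update_apply]
    split_ifs with h1 h2 h3 h4 h5
    · exact absurd (h2.symm.trans h1) hav
    · exact le_rfl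
    · exact absurd (h4.symm.trans h3) hab
    · exact le_rfl
    · rw [h5]
    · exact min_le_right _ _
  exact (add_le_add (mul_le_mul_of_nonneg_left hleft hζ.1)
    (mul_le_mul_of_nonneg_left hright (sub_nonneg.2 hζ.2))).trans hconc

/-- The outer bound for a single scheme, where `Δ` bounds the equivocations. -/
theorem Gamma_le_channelEntropy (hμ : ∀ i j : Fin K, i ≠ j → 0 ≤ μ i j ∧ μ i j ≤ 1)
    (T : OuterBoundTree K) (S : Scheme K n) {Δ : ℝ}
    (hΔ : ∀ i, Real.log 2 + S.errorProb μ i * (S.m i * Real.log 2) ≤ Δ) (k : ℕ) :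
    ∀ ℓ i : ℕ, 1 ≤ ℓ → ℓ + 1 + k = K → 1 ≤ i → i ≤ 2 ^ (ℓ - 1) →
      (Odd i → GammaA μ (fun j => S.m j * Real.log 2) T.label ℓ i ≤
        channelEntropy S (eta μ T.label ℓ i) + (k + 2) * Δ) ∧
      (Even i → GammaB μ (fun j => S.m j * Real.log 2) T.label ℓ i ≤
        channelEntropy S (eta μ T.label ℓ i) + (k + 2) * Δ) := by
  -- Each decoding costs one `Δ`. A path from level `ℓ` down to a leaf has `k + 2` nodes, and
  -- branching only averages the costs.
  have hdec : ∀ ℓ i, eta μ T.label ℓ i (T.label ℓ i) * (S.m (T.label ℓ i) * Real.log 2) +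
      channelEntropy S (update (eta μ T.label ℓ i) (T.label ℓ i) 0) ≤
      channelEntropy S (eta μ T.label ℓ i) + Δ := by
    intro ℓ i
    have := channelEntropy_decode μ S (T.label ℓ i) (fun j hj => (hμ _ _ hj.symm).2)
      (fun j => (eta_mem_Icc hμ T.label ℓ i j).1) (fun j => (eta_mem_Icc hμ T.label ℓ i j).2)
      (fun j hj => eta_le_mu hμ _ _ _ hj)
    linarith [hΔ (T.label ℓ i)]
  -- An odd node has value 1 at its own label, an even one inherits the value from its parent: this
  -- is the difference between `GammaA` and `GammaB`.
  have hself : ∀ ℓ i, 1 ≤ ℓ → ℓ < K → 1 ≤ i → i ≤ 2 ^ (ℓ - 1) → Even i →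
      eta μ T.label ℓ i (T.label ℓ i) = eta μ T.label (ℓ - 1) ((i + 1) / 2) (T.label ℓ i) := by
    intro ℓ i hℓ hℓK hi hi' he
    obtain ⟨c, hc⟩ := he
    obtain ⟨ℓ, rfl⟩ : ∃ k, ℓ = k + 1 := ⟨ℓ - 1, by omega⟩
    have hℓ1 : 1 ≤ ℓ := by
      by_contra h0
      obtain rfl : ℓ = 0 := by omega
      simp at hi'
      omega
    obtain rfl : i = 2 * c := by omega
    have := T.label_succ_ne (c := 2 * c) hℓ1 hℓK hi hi'
    rw [show (2 * c + 1) / 2 = c by omega] at this ⊢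
    rw [eta_right _ hℓ1, if_neg this, if_pos rfl]
    rfl
  induction k with
  | zero =>
    intro ℓ i hℓ hℓK hi hi'
    have hK : ℓ + 1 = K := by omega
    set v := T.label ℓ i with hv
    set u := T.label (ℓ + 1) i with hu
    set η' := update (eta μ T.label ℓ i) v 0 with hη'
    have hη'01 : ∀ j, 0 ≤ η' j ∧ η' j ≤ 1 := by
      intro j
      rw [hη', update_apply]
      split_ifs
      · simp
      · exact eta_mem_Icc hμ _ _ _ _
    have hi2 : i ≤ 2 ^ (K - 2) := by rwa [show K - 2 = ℓ - 1 by omega]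
    have huv : u ≠ v := by
      intro h
      have := T.label_path_ne hi hi2 hℓ (Nat.lt_succ_self ℓ) hK.le
      simp only [pathIndex, show K - 1 - ℓ = 0 by omega, show K - 1 - (ℓ + 1) = 0 by omega,
        Nat.succ_eq_add_one, iterate_zero, id] at this
      exact this h.symm
    have h1 := hdec ℓ i
    -- Once message `v` is known, only message `u` has a nonzero erasure probability, so user `u`
    -- can decode whatever its side information.
    have h2 := channelEntropy_decode μ S u (fun j hj => (hμ _ _ hj.symm).2)
      (fun j => (hη'01 j).1) (fun j => (hη'01 j).2) (fun j hj => by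
        rw [hη', update_apply]
        split_ifs with h
        · exact (hμ _ _ hj.symm).1
        · rw [T.eta_eq_zero hμ hK hi hi2 h hj]
          exact (hμ _ _ hj.symm).1)
    have h3 : 0 ≤ channelEntropy S (update η' u 0) := by
      refine channelEntropy_nonneg S (fun j => ?_) (fun j => ?_) <;>
      · rw [update_apply]
        split_ifs
        · simp
        · first | exact (hη'01 j).1 | exact (hη'01 j).2
    have h4 := hΔ u
    have h5 : η' u = eta μ T.label ℓ i u := by rw [hη', update_of_ne huv]
    have hζ : zeta μ T.label ℓ i = eta μ T.label ℓ i u := by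
      rw [zeta, if_neg (by omega), if_pos hK]
    rw [h5] at h2
    constructor
    · intro ho
      rw [eta_self_of_odd _ hℓ ho] at h1
      rw [GammaA, if_neg (by omega), if_pos hK, hζ]
      push_cast
      linarith
    · intro he
      rw [hself ℓ i hℓ (by omega) hi hi' he] at h1
      rw [GammaB, if_neg (by omega), if_pos hK, hζ]
      push_cast
      linarith
  | succ k ih =>
    intro ℓ i hℓ hℓK hi hi'
    have hK : ℓ + 1 < K := by omega
    have h2i : 2 * i ≤ 2 ^ (ℓ + 1 - 1) := by
      obtain ⟨k, rfl⟩ : ∃ k, ℓ = k + 1 := ⟨ℓ - 1, by omega⟩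
      rw [Nat.add_sub_cancel, pow_succ']
      exact Nat.mul_le_mul_left 2 hi'
    have hA := (ih (ℓ + 1) (2 * i - 1) (by omega) (by omega) (by omega) (by omega)).1
      ⟨i - 1, by omega⟩
    have hB := (ih (ℓ + 1) (2 * i) (by omega) (by omega) (by omega) h2i).2 (even_two_mul i)
    have hζ := zeta_mem_Icc hμ hK (T.siblings_ne ℓ i hℓ hK hi hi')
    have hbr := channelEntropy_branch hμ T S hℓ hK hi hi'
    have h1 := hdec ℓ i
    have hA' := mul_le_mul_of_nonneg_left hA hζ.1
    have hB' := mul_le_mul_of_nonneg_left hB (sub_nonneg.2 hζ.2)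
    constructor
    · intro ho
      rw [eta_self_of_odd _ hℓ ho] at h1
      rw [GammaA, if_pos hK]
      push_cast
      linarith
    · intro he
      rw [hself ℓ i hℓ (by omega) hi hi' he] at h1
      rw [GammaB, if_pos hK]
      push_cast
      linarith

/-- Homogeneity in the rates, used to divide by log 2 and by the block length. `k` bounds the number
of remaining levels; from level K on both quantities are 0. -/
lemma Gamma_mul_const (μ : Fin K → Fin K → ℝ) (r : Fin K → ℝ) (c : ℝ) (v : ℕ → ℕ → Fin K)
    (k : ℕ) : ∀ ℓ i : ℕ, K ≤ ℓ + k →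
      GammaA μ (fun j => r j * c) v ℓ i = GammaA μ r v ℓ i * c ∧
      GammaB μ (fun j => r j * c) v ℓ i = GammaB μ r v ℓ i * c := by
  induction k with
  | zero =>
    intro ℓ i h
    rw [GammaA.eq_1 (r := fun j => r j * c) (ℓ := ℓ), GammaA.eq_1 (r := r) (ℓ := ℓ),
      GammaB.eq_1 (r := fun j => r j * c) (ℓ := ℓ), GammaB.eq_1 (r := r) (ℓ := ℓ)]
    simp [show ¬ ℓ + 1 < K by omega, show ¬ ℓ + 1 = K by omega]
  | succ k ih =>
    intro ℓ i h
    rw [GammaA.eq_1 (r := fun j => r j * c) (ℓ := ℓ), GammaA.eq_1 (r := r) (ℓ := ℓ),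
      GammaB.eq_1 (r := fun j => r j * c) (ℓ := ℓ), GammaB.eq_1 (r := r) (ℓ := ℓ),
      (ih (ℓ + 1) (2 * i - 1) (by omega)).1, (ih (ℓ + 1) (2 * i) (by omega)).2]
    constructor <;> split_ifs <;> ring

lemma continuous_Gamma (μ : Fin K → Fin K → ℝ) (v : ℕ → ℕ → Fin K) (k : ℕ) :
    ∀ ℓ i : ℕ, K ≤ ℓ + k →
      Continuous (fun r => GammaA μ r v ℓ i) ∧ Continuous (fun r => GammaB μ r v ℓ i) := by
  induction k with
  | zero =>
    intro ℓ i h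
    constructor
    · have : (fun r => GammaA μ r v ℓ i) = fun _ => 0 := by
        funext r
        rw [GammaA, if_neg (by omega), if_neg (by omega)]
      rw [this]
      exact continuous_const
    · have : (fun r => GammaB μ r v ℓ i) = fun _ => 0 := by
        funext r
        rw [GammaB, if_neg (by omega), if_neg (by omega)]
      rw [this]
      exact continuous_const
  | succ k ih =>
    intro ℓ i h
    have hA := (ih (ℓ + 1) (2 * i - 1) (by omega)).1
    have hB := (ih (ℓ + 1) (2 * i) (by omega)).2
    constructor
    · have : (fun r => GammaA μ r v ℓ i) = _ := funext fun r => by rw [GammaA]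
      rw [this]
      split_ifs <;> fun_prop
    · have : (fun r => GammaB μ r v ℓ i) = _ := funext fun r => by rw [GammaB]
      rw [this]
      split_ifs <;> fun_prop

end Tree

end BIC

end

/-- Outer bound on the capacity region of the `K`-user blind index coding problem. -/
theorem theorem3 (K : ℕ) (hK : 3 ≤ K) (μ : Fin K → Fin K → ℝ)
    (hμ : ∀ i j : Fin K, i ≠ j → 0 ≤ μ i j ∧ μ i j ≤ 1)
    (r : Fin K → ℝ) (hr : BIC.Achievable μ r) (T : BIC.OuterBoundTree K) :
    BIC.GammaA μ r T.label 1 1 ≤ 1 := by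
  obtain ⟨N, S, hN, hm, he⟩ := hr
  have hlog : (0 : ℝ) < Real.log 2 := Real.log_pos one_lt_two
  have hpos : ∀ t i, 0 ≤ (S t).errorProb μ i := by
    intro t i
    rw [← BIC.erasureMean_condError]
    have hu : ∀ j, 0 ≤ BIC.userErasure μ i j ∧ BIC.userErasure μ i j ≤ 1 := by
      intro j
      by_cases h : j = i
      · simp [BIC.userErasure, h]
      · simpa [BIC.userErasure, h] using hμ i j (Ne.symm h)
    refine Finset.sum_nonneg fun s _ => mul_nonneg
      (BIC.patternProb_nonneg (fun b => (hu b.1).1) (fun b => (hu b.1).2) s) ?_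
    exact div_nonneg (Finset.sum_nonneg fun w _ => by split_ifs <;> norm_num) (Nat.cast_nonneg _)
  have hbound : ∀ t, 0 < N t → BIC.GammaA μ (fun j => ((S t).m j : ℝ) / N t) T.label 1 1 ≤
      1 + K * (1 / N t + ∑ i, (S t).errorProb μ i * ((S t).m i / N t)) := by
    intro t ht
    have hn : (0 : ℝ) < N t := by exact_mod_cast ht
    -- Summing the errors over all users gives one `Δ` for every decoding; at the root `k = K - 2`,
    -- for a total of `K * Δ`.
    have h1 := (BIC.Gamma_le_channelEntropy hμ T (S t)
      (Δ := Real.log 2 + (∑ i, (S t).errorProb μ i * (S t).m i) * Real.log 2) (fun i => by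
        have := Finset.single_le_sum
          (fun i _ => mul_nonneg (hpos t i) (Nat.cast_nonneg ((S t).m i))) (Finset.mem_univ i)
        have := mul_le_mul_of_nonneg_right this hlog.le
        linarith) (K - 2) 1 1 le_rfl (by omega) le_rfl (by simp)).1 odd_one
    have h2 := BIC.channelEntropy_le (S t)
      (fun j => (BIC.eta_mem_Icc hμ T.label 1 1 j).1) (fun j => (BIC.eta_mem_Icc hμ T.label 1 1 j).2)
    rw [(BIC.Gamma_mul_const μ (fun j => ((S t).m j : ℝ)) (Real.log 2) T.label K 1 1 (by omega)).1,
      show ((K - 2 : ℕ) : ℝ) + 2 = K by rw [Nat.cast_sub (by omega)]; ring] at h1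
    have h3 : BIC.GammaA μ (fun j => ((S t).m j : ℝ)) T.label 1 1 ≤
        N t + K * (1 + ∑ i, (S t).errorProb μ i * (S t).m i) := by
      refine le_of_mul_le_mul_right ?_ hlog
      linarith
    simp only [div_eq_mul_inv]
    rw [(BIC.Gamma_mul_const μ (fun j => ((S t).m j : ℝ)) (N t : ℝ)⁻¹ T.label K 1 1 (by omega)).1]
    refine (mul_le_mul_of_nonneg_right h3 (inv_nonneg.2 hn.le)).trans (le_of_eq ?_)
    simp only [← mul_assoc]
    rw [← Finset.sum_mul]
    field_simp
  have hNt : Tendsto (fun t => (1 : ℝ) / N t) atTop (𝓝 0) :=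
    tendsto_one_div_atTop_nhds_zero_nat.comp hN.tendsto_atTop
  -- The Fano terms vanish because the ratios `m i / N t` converge while the error probabilities
  -- tend to 0.
  have hlim : Tendsto (fun t => 1 + (K : ℝ) *
      (1 / N t + ∑ i, (S t).errorProb μ i * ((S t).m i / N t))) atTop (𝓝 1) := by
    have h1 : Tendsto (fun t => ∑ i, (S t).errorProb μ i * ((S t).m i / N t)) atTop
        (𝓝 (∑ i, 0 * r i)) := tendsto_finsetSum _ fun i _ => (he i).mul (hm i)
    have h2 := (tendsto_const_nhds (x := (1 : ℝ))).add
      ((hNt.add h1).const_mul (K : ℝ))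
    simpa using h2
  have hΓ : Tendsto (fun t => BIC.GammaA μ (fun j => ((S t).m j : ℝ) / N t) T.label 1 1) atTop
      (𝓝 (BIC.GammaA μ r T.label 1 1)) :=
    ((BIC.continuous_Gamma μ T.label K 1 1 (by omega)).1.tendsto r).comp (tendsto_pi_nhds.2 hm)
  refine le_of_tendsto_of_tendsto hΓ hlim ?_
  filter_upwards [hN.tendsto_atTop.eventually_gt_atTop 0] with t ht
  exact hbound t ht
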